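/- Let $q>4$ be a prime power and let $n\ge 0$. A linear code of length $m$ over $\mathbb{F}_q$ is a linear subspace $\mathcal{C}\le\mathbb{F}_q^m$; the weight $\mathrm{wt}(c)$ of a codeword $c$ is the number of its nonzero coordinates, and the homogeneous weight enumerator of $\mathcal{C}$ is $$W_{\mathcal{C}}(x,y)=\sum_{c\in\mathcal{C}}x^{m-\mathrm{wt}(c)}y^{\mathrm{wt}(c)}\in\mathbb{C}[x,y].$$ The code $\mathcal{C}$ is divisible if there is an integer $\Delta>1$ that divides $\mathrm{wt}(c)$ for every $c\in\mathcal{C}$, and it is formally self-dual if $$W_{\mathcal{C}}\left(\frac{x+(q-1)y}{\sqrt q},\frac{x-y}{\sqrt q}\right)=W_{\mathcal{C}}(x,y).$$ Two codes of length $m$ are equivalent if one is the image of the other under a monomial transformation $v\mapsto DPv$, where $D$ is an $m\times m$ diagonal matrix over $\mathbb{F}_q$ with nonzero diagonal entries and $P$ is an $m\times m$ permutation matrix. Then every formally self-dual divisible linear code $\mathcal{C}\le\mathbb{F}_q^{2n}$ is equivalent to the direct sum $\langle(1,1)\rangle_{\mathbb{F}_q}\oplus\cdots\oplus\langle(1,1)\rangle_{\mathbb{F}_q}$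 of $n$ copies of the code of length $2$ spanned by $(1,1)$. -/

import Mathlib

namespace LinCode

/-- A linear code of length `n` over `F`: a linear subspace of `F ^ n`. -/
abbrev LinearCode (F : Type*) [Field F] (n : ℕ) := Submodule F (Fin n → F)

variable {F : Type*} [Field F]

/-- The monomial transformation `v ↦ D P v` of `F ^ n`, with `D` the diagonal matrix of entries `d`
and `P` the permutation matrix of `σ`; it is only used with nonzero entries `d i`. -/
def monomialMap {n : ℕ} (d : Fin n → F) (σ : Equiv.Perm (Fin n)) :
    (Fin n → F) →ₗ[F] (Fin n → F) :=
  Matrix.toLin' (Matrix.diagonal d * σ.permMatrix F)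

/-- Two codes are equivalent if one is the image of the other under a monomial transformation. -/
def IsEquivalent {n : ℕ} (C D : LinearCode F n) : Prop :=
  ∃ (d : Fin n → F) (σ : Equiv.Perm (Fin n)), (∀ i, d i ≠ 0) ∧ C.map (monomialMap d σ) = D

/-- The direct sum of two codes: the vectors of length `m + n` whose first `m` coordinates form a
codeword of `C` and whose last `n` coordinates form a codeword of `D`. -/
def directSum {m n : ℕ} (C : LinearCode F m) (D : LinearCode F n) : LinearCode F (m + n) :=
  C.comap (LinearMap.funLeft F F (Fin.castAdd n)) ⊓ D.comap (LinearMap.funLeft F F (Fin.natAdd m))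

/-- The direct sum `C ⊕ ⋯ ⊕ C` of `k` copies of a code `C` (the zero code of length `0` when
`k = 0`). -/
def directSumCopies {m : ℕ} (C : LinearCode F m) : (k : ℕ) → LinearCode F (m * k)
  | 0 => ⊥
  | k + 1 => directSum (directSumCopies C k) C

/-- The code of length `2` spanned by `(1, 1)`. -/
def repetitionCode (F : Type*) [Field F] : LinearCode F 2 :=
  Submodule.span F {![1, 1]}

/-- `C` is divisible: some integer `Δ > 1` divides the weights of all codewords. -/
def IsDivisible [DecidableEq F] {n : ℕ} (C : LinearCode F n) : Prop :=
  ∃ Δ : ℕ, 1 < Δ ∧ ∀ c ∈ C, Δ ∣ hammingNorm c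

open scoped Classical in
/-- The homogeneous weight enumerator `∑ c ∈ C, x ^ (n - wt c) * y ^ (wt c)` in `ℂ[x, y]`, where
`x = X 0` and `y = X 1`. -/
noncomputable def weightEnumerator [Fintype F] [DecidableEq F] {n : ℕ} (C : LinearCode F n) :
    MvPolynomial (Fin 2) ℂ :=
  ∑ c : Fin n → F with c ∈ C,
    MvPolynomial.X 0 ^ (n - hammingNorm c) * MvPolynomial.X 1 ^ hammingNorm c

/-- The linear substitution `p(x, y) ↦ p(a x + b y, c x + d y)` for `A = !![a, b; c, d]`. -/
noncomputable def substitute (A : Matrix (Fin 2) (Fin 2) ℂ) (p : MvPolynomial (Fin 2) ℂ) :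
    MvPolynomial (Fin 2) ℂ :=
  MvPolynomial.bind₁
    (fun i => MvPolynomial.C (A i 0) * MvPolynomial.X 0 + MvPolynomial.C (A i 1) * MvPolynomial.X 1)
    p

/-- The MacWilliams matrix `S_q = q ^ (-1/2) * !![1, q - 1; 1, -1]` (of determinant `-1`). -/
noncomputable def macWilliamsMatrix (q : ℕ) : Matrix (Fin 2) (Fin 2) ℂ :=
  ((Real.sqrt q : ℝ) : ℂ)⁻¹ • !![1, (q : ℂ) - 1; 1, -1]

/-- `C` is formally self-dual: its homogeneous weight enumerator is invariant under `S_q`. -/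
def IsFormallySelfDual [Fintype F] [DecidableEq F] {n : ℕ} (C : LinearCode F n) : Prop :=
  substitute (macWilliamsMatrix (Fintype.card F)) (weightEnumerator C) = weightEnumerator C

end LinCode

open Polynomial

namespace LinCode

/-! The roots of `weightPolynomial C` form a finite set avoiding 1. It is stable under
`macWilliamsMoebius q` by formal self-duality, and under multiplication by a primitive `D`-th root
of unity `ζ` when `D` divides all weights. If a root is not fixed by `U z = macWilliamsMoebius q (ζ
^ k * z)`, its finite orbit makes `(1 - ζ ^ k) * (1 - (ζ ^ k)⁻¹) / q` an algebraic integer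
(`isIntegral_of_finite_orbit`). Over `0 < k < D` these numbers multiply to `D ^ 2 / q ^ (D - 1)`,
which lies strictly between 0 and 1 as `q > 4`, so for some `k` every root is fixed. This forces `ζ
^ k = -1` and `a ^ 2 = 1 - q` for each root `a`.

Vieta's formulas then give exactly `n * (q - 1)` words of weight 2, whence `D = 2`. Even weights
make the supports of these words equal or disjoint, with at most `q - 1` words on each, so `n`
disjoint pairs fill all coordinates and determine the code. -/

/-! ### Finite orbits of Möbius transformations and integrality. -/

/-- The Möbius transformation of the matrix `!![1, q - 1; 1, -1]`. -/
noncomputable def macWilliamsMoebius (q z : ℂ) : ℂ := (z + q - 1) / (z - 1)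

theorem macWilliamsMoebius_involutive {q z : ℂ} (hq : q ≠ 0) (hz : z ≠ 1) :
    macWilliamsMoebius q (macWilliamsMoebius q z) = z := by
  have h : z - 1 ≠ 0 := sub_ne_zero.mpr hz
  have h' : (z + q - 1) / (z - 1) - 1 = q / (z - 1) := by field_simp; ring
  unfold macWilliamsMoebius
  rw [h']
  field_simp
  ring

/-- A point with a finite orbit under `z ↦ S (ζ z)` that is not a fixed point forces the two
eigenvalues of the transformation to differ by a root of unity. -/
theorem isIntegral_of_finite_orbit {q ζ : ℂ} (hq : q ≠ 0) (hζ : ζ ≠ 0) {R : Set ℂ}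
    (hfin : R.Finite) (hmul : ∀ z ∈ R, ζ * z ∈ R) (hne : (1 : ℂ) ∉ R)
    (hS : ∀ z ∈ R, macWilliamsMoebius q z ∈ R) {a : ℂ} (ha : a ∈ R)
    (hfix : macWilliamsMoebius q (ζ * a) ≠ a) :
    IsIntegral ℤ ((1 - ζ) * (1 - ζ⁻¹) / q) := by
  -- `l` and `m` are the eigenvalues of `!![ζ, q - 1; ζ, -1]`, the matrix of `z ↦ S (ζ z)`, with
  -- trace `ζ - 1` and determinant `-qζ`.
  obtain ⟨s, hs⟩ := IsAlgClosed.exists_pow_nat_eq ((ζ - 1) ^ 2 + 4 * (q * ζ)) two_pos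
  obtain ⟨l, hl⟩ : ∃ l, l = (ζ - 1 + s) / 2 := ⟨_, rfl⟩
  obtain ⟨m, hm⟩ : ∃ m, m = (ζ - 1 - s) / 2 := ⟨_, rfl⟩
  have hadd : l + m = ζ - 1 := by rw [hl, hm]; ring
  have hprod : l * m = -(q * ζ) := by
    rw [hl, hm]; linear_combination (-1 / 4) * hs
  have hlm : l * m ≠ 0 := by rw [hprod]; exact neg_ne_zero.mpr (mul_ne_zero hq hζ)
  have hl0 : l ≠ 0 := left_ne_zero_of_mul hlm
  have hm0 : m ≠ 0 := right_ne_zero_of_mul hlm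
  have hlq : l ^ 2 = (ζ - 1) * l + q * ζ := by linear_combination l * hadd - hprod
  have hmq : m ^ 2 = (ζ - 1) * m + q * ζ := by linear_combination m * hadd - hprod
  have hden : ∀ z ∈ R, ζ * z - 1 ≠ 0 := fun z hz h =>
    hne (by rw [← sub_eq_zero.mp h]; exact hmul z hz)
  set U : ℂ → ℂ := fun z => macWilliamsMoebius q (ζ * z) with hU
  have hUR : ∀ z ∈ R, U z ∈ R := fun z hz => hS _ (hmul z hz)
  -- `(ζ, k - ζ)` is a left eigenvector for the eigenvalue `k`; its linear form vanishes only at a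
  -- fixed point of `U`.
  have hlin : ∀ k : ℂ, k ^ 2 = (ζ - 1) * k + q * ζ → ∀ z ∈ R,
      ζ * U z + k - ζ = k * (ζ * z + k - ζ) / (ζ * z - 1) := by
    intro k hk z hz
    have := hden z hz
    simp only [hU, macWilliamsMoebius]
    field_simp
    linear_combination -hk
  have hnz : ∀ k : ℂ, k ^ 2 = (ζ - 1) * k + q * ζ → ζ * a + k - ζ ≠ 0 := by
    intro k hk h
    apply hfix
    have h1 := hlin k hk a ha
    rw [h, mul_zero, zero_div] at h1
    exact mul_left_cancel₀ hζ (by linear_combination h1 - h)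
  -- In the coordinate `w`, `U` is multiplication by `l / m`. The case `l = m` is harmless: then `l
  -- / m = 1`.
  set w : ℂ → ℂ := fun z => (ζ * z + l - ζ) / (ζ * z + m - ζ) with hw
  have hwU : ∀ z ∈ R, w (U z) = l / m * w z := by
    intro z hz
    simp only [hw]
    rw [hlin l hlq z hz, hlin m hmq z hz, div_div_div_cancel_right₀ (hden z hz),
      mul_div_mul_comm]
  have hiter : ∀ j : ℕ, U^[j] a ∈ R ∧ w (U^[j] a) = (l / m) ^ j * w a := by
    intro j
    induction j with
    | zero => simpa using ha
    | succ j ih =>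
      rw [Function.iterate_succ_apply']
      exact ⟨hUR _ ih.1, by rw [hwU _ ih.1, ih.2]; ring⟩
  have : Finite R := hfin
  obtain ⟨i, j, hij, h⟩ :=
    Finite.exists_ne_map_eq_of_infinite (fun j : ℕ => (⟨U^[j] a, (hiter j).1⟩ : R))
  have h' : (l / m) ^ i = (l / m) ^ j := by
    have h2 : U^[i] a = U^[j] a := congrArg Subtype.val h
    have h3 := (hiter i).2
    rw [h2, (hiter j).2] at h3
    exact (mul_right_cancel₀ (div_ne_zero (hnz l hlq) (hnz m hmq)) h3).symm
  have hω : l / m ≠ 0 := div_ne_zero hl0 hm0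
  obtain ⟨N, hN, hpow⟩ : ∃ N : ℕ, 0 < N ∧ (l / m) ^ N = 1 := by
    wlog hlt : i < j generalizing i j
    · exact this j i hij.symm h.symm h'.symm (lt_of_le_of_ne (not_lt.mp hlt) hij.symm)
    · refine ⟨j - i, Nat.sub_pos_of_lt hlt, mul_left_cancel₀ (pow_ne_zero i hω) ?_⟩
      rw [← pow_add, Nat.add_sub_cancel' hlt.le, mul_one, h']
  have hint : IsIntegral ℤ (l / m) := IsIntegral.of_pow hN (hpow ▸ isIntegral_one)
  have hint' : IsIntegral ℤ (l / m)⁻¹ :=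
    IsIntegral.of_pow hN (by rw [inv_pow, hpow, inv_one]; exact isIntegral_one)
  have heq : (1 - ζ) * (1 - ζ⁻¹) / q = l / m + (l / m)⁻¹ + 2 := by
    have e1 : l / m + (l / m)⁻¹ + 2 = (l + m) ^ 2 / (l * m) := by field_simp; ring
    rw [e1, hadd, hprod]
    field_simp
    ring
  rw [heq]
  exact (hint.add hint').add (isIntegral_algebraMap (x := (2 : ℤ)))

/-- This is `D ^ 2 < q ^ (D - 1)` at the worst case `q = 5`, with `D = d + 2`; for `q = 4`, `D = 2`
there is equality. -/
theorem sq_lt_five_pow (d : ℕ) : (d + 2) ^ 2 < 5 ^ (d + 1) := by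
  induction d with
  | zero => norm_num
  | succ d ih => rw [pow_succ 5 (d + 1)]; nlinarith

/-- Otherwise the product over all `k` would be a rational algebraic integer strictly between 0 and
1, since `∏ (1 - ζ ^ k) = D` for both `ζ` and `ζ⁻¹`. -/
theorem exists_not_isIntegral {q D : ℕ} (hq : 4 < q) (hD : 1 < D) {ζ : ℂ}
    (hζ : IsPrimitiveRoot ζ D) :
    ∃ k, 0 < k ∧ k < D ∧ ¬ IsIntegral ℤ ((1 - ζ ^ k) * (1 - (ζ ^ k)⁻¹) / (q : ℂ)) := by
  by_contra! hcon
  obtain ⟨d, rfl⟩ : ∃ d, D = d + 2 := ⟨D - 2, by omega⟩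
  have hq0 : (q : ℂ) ≠ 0 := by exact_mod_cast (by omega : q ≠ 0)
  have hint : IsIntegral ℤ
      (∏ k ∈ Finset.range (d + 1), ((1 - ζ ^ (k + 1)) * (1 - (ζ ^ (k + 1))⁻¹) / (q : ℂ))) :=
    IsIntegral.prod _ fun k hk =>
      hcon (k + 1) (Nat.succ_pos k) (by have := Finset.mem_range.mp hk; omega)
  have hval : ∏ k ∈ Finset.range (d + 1), ((1 - ζ ^ (k + 1)) * (1 - (ζ ^ (k + 1))⁻¹) / (q : ℂ))
      = algebraMap ℚ ℂ ((d + 2 : ℚ) ^ 2 / (q : ℚ) ^ (d + 1)) := by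
    have h1 := hζ.prod_one_sub_pow_eq_order
    have h2 := hζ.inv.prod_one_sub_pow_eq_order
    simp only [inv_pow] at h2
    rw [Finset.prod_div_distrib, Finset.prod_mul_distrib, h1, h2, Finset.prod_const,
      Finset.card_range]
    push_cast [map_div₀, map_pow, map_add]
    simp
    ring
  rw [hval, isIntegral_algebraMap_iff (algebraMap ℚ ℂ).injective,
    IsIntegrallyClosed.isIntegral_iff] at hint
  obtain ⟨y, hy⟩ := hint
  have hqd : (0 : ℚ) < (q : ℚ) ^ (d + 1) := by positivity
  have hlt : (d + 2 : ℚ) ^ 2 / (q : ℚ) ^ (d + 1) < 1 := by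
    rw [div_lt_one hqd]
    have h1 : (d + 2) ^ 2 < q ^ (d + 1) :=
      (sq_lt_five_pow d).trans_le (Nat.pow_le_pow_left hq _)
    exact_mod_cast h1
  have hpos : (0 : ℚ) < (d + 2 : ℚ) ^ 2 / (q : ℚ) ^ (d + 1) := by positivity
  rw [← hy, eq_intCast] at hlt hpos
  have h1 : y < 1 := by exact_mod_cast hlt
  have h2 : 0 < y := by exact_mod_cast hpos
  omega

theorem sq_eq_of_mem_finite_invariant {q D : ℕ} (hq : 4 < q) (hD : 1 < D) {ζ : ℂ}
    (hζ : IsPrimitiveRoot ζ D) {R : Set ℂ} (hfin : R.Finite) (hmul : ∀ z ∈ R, ζ * z ∈ R)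
    (hne : (1 : ℂ) ∉ R) (hS : ∀ z ∈ R, macWilliamsMoebius q z ∈ R) {a : ℂ} (ha : a ∈ R) :
    a ^ 2 = 1 - q := by
  obtain ⟨k, hk0, hkD, hk⟩ := exists_not_isIntegral hq hD hζ
  have hq0 : (q : ℂ) ≠ 0 := by exact_mod_cast (by omega : q ≠ 0)
  have hq1 : (q : ℂ) ≠ 1 := by exact_mod_cast (by omega : q ≠ 1)
  have hζ0 : ζ ^ k ≠ 0 := pow_ne_zero k (hζ.ne_zero (by omega))
  have hmulk : ∀ z ∈ R, ζ ^ k * z ∈ R := by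
    intro z hz
    clear hk hk0 hkD hζ0
    induction k with
    | zero => simpa using hz
    | succ k ih => rw [pow_succ', mul_assoc]; exact hmul _ ih
  have hfix : ∀ z ∈ R, macWilliamsMoebius q (ζ ^ k * z) = z := by
    by_contra! h
    obtain ⟨z, hz, hz'⟩ := h
    exact hk (isIntegral_of_finite_orbit hq0 hζ0 hfin hmulk hne hS hz hz')
  have hne1 : ∀ z ∈ R, z ≠ 1 := fun z hz h => hne (h ▸ hz)
  -- On `R` the involution coincides with multiplication by `ζ ^ k`, so `ζ ^ (2 * k) = 1`.
  have hS' : ∀ z ∈ R, macWilliamsMoebius q z = ζ ^ k * z := fun z hz => by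
    conv_lhs => rw [← hfix z hz]
    exact macWilliamsMoebius_involutive hq0 (hne1 _ (hmulk z hz))
  have ha0 : a ≠ 0 := by
    rintro rfl
    have := hS' 0 ha
    rw [macWilliamsMoebius, mul_zero, div_eq_zero_iff] at this
    rcases this with h | h
    · exact hq1 (by linear_combination h)
    · norm_num at h
  have h1 : ζ ^ k * (ζ ^ k * a) = a := by
    rw [← hS' _ (hmulk a ha)]; exact hfix a ha
  have h2 : (ζ ^ k - 1) * (ζ ^ k + 1) = 0 := by
    apply mul_right_cancel₀ ha0
    linear_combination h1
  have h3 : ζ ^ k = -1 := by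
    rcases mul_eq_zero.mp h2 with h | h
    · exact absurd (sub_eq_zero.mp h) (hζ.pow_ne_one_of_pos_of_lt hk0.ne' hkD)
    · linear_combination h
  have h4 := hS' a ha
  have h5 : a - 1 ≠ 0 := sub_ne_zero.mpr (hne1 a ha)
  rw [h3, macWilliamsMoebius, div_eq_iff h5] at h4
  linear_combination h4

/-! ### Second elementary symmetric function of the roots. -/

theorem two_mul_esymm_two {R : Type*} [CommRing R] (s : Multiset R) :
    2 * s.esymm 2 = s.sum ^ 2 - (s.map (· ^ 2)).sum := by
  induction s using Multiset.induction_on with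
  | empty => simp [Multiset.esymm, Multiset.powersetCard_zero_right]
  | cons a s ih =>
    have h : (a ::ₘ s).esymm 2 = s.esymm 2 + a * s.sum := by
      have h' : (s.map (a * ·)).sum = a * s.sum := by
        simpa using Multiset.sum_map_mul_left (s := s) (a := a) (f := id)
      simp [Multiset.esymm, Multiset.powersetCard_cons, Multiset.powersetCard_one,
        Multiset.map_map, h']
    rw [h, Multiset.sum_cons, Multiset.map_cons, Multiset.sum_cons]
    linear_combination ih

/-- The second coefficient of a monic polynomial whose roots have the same square. -/
theorem coeff_eq_of_roots_sq_eq {p : ℂ[X]} (hp : p.Monic) {N : ℕ} (hN : p.natDegree = N + 2)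
    (h1 : p.coeff (N + 1) = 0) {t : ℂ} (ht : ∀ a ∈ p.roots, a ^ 2 = t) :
    2 * p.coeff N = -((N + 2) * t) := by
  have hc : p.roots.card = p.natDegree := IsAlgClosed.card_roots_eq_natDegree
  rw [coeff_eq_esymm_roots_of_card hc (by omega), hN, hp.leadingCoeff,
    show N + 2 - (N + 1) = 1 by omega] at h1
  have hsum : p.roots.sum = 0 := by
    simpa [Multiset.esymm, Multiset.powersetCard_one, Multiset.map_map, Function.comp_def] using h1
  rw [coeff_eq_esymm_roots_of_card hc (by omega), hN, hp.leadingCoeff,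
    show N + 2 - N = 2 by omega]
  have h2 : p.roots.map (· ^ 2) = Multiset.replicate (N + 2) t := by
    rw [Multiset.map_congr rfl ht, Multiset.map_const', hc, hN]
  have h3 := two_mul_esymm_two p.roots
  rw [hsum, h2, Multiset.sum_replicate, nsmul_eq_mul] at h3
  push_cast at h3
  linear_combination h3

/-! ### The weight polynomial and the symmetries of its roots. -/

open scoped Classical in
/-- The dehomogenised weight enumerator `∑ c ∈ C, X ^ (m - wt c)`. -/
noncomputable def weightPolynomial {F : Type*} [Field F] [Fintype F] [DecidableEq F] {m : ℕ}
    (C : LinearCode F m) : ℂ[X] :=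
  ∑ c : Fin m → F with c ∈ C, X ^ (m - hammingNorm c)

open scoped Classical in
/-- The codewords of weight `w`. -/
noncomputable def wordsOfWeight {F : Type*} [Field F] [Fintype F] [DecidableEq F] {m : ℕ}
    (C : LinearCode F m) (w : ℕ) : Finset (Fin m → F) :=
  {c | c ∈ C ∧ hammingNorm c = w}

theorem hammingNorm_le {F : Type*} [Field F] [DecidableEq F] {m : ℕ} (c : Fin m → F) :
    hammingNorm c ≤ m := by
  simpa using hammingNorm_le_card_fintype (x := c)

section

variable {F : Type*} [Field F] [Fintype F] [DecidableEq F] {m : ℕ} {C : LinearCode F m}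

theorem mem_wordsOfWeight {w : ℕ} {c : Fin m → F} :
    c ∈ wordsOfWeight C w ↔ c ∈ C ∧ hammingNorm c = w := by
  simp [wordsOfWeight]

theorem eval_weightEnumerator (x : ℂ) {y : ℂ} (hy : y ≠ 0) :
    MvPolynomial.eval ![x, y] (weightEnumerator C) =
      y ^ m * (weightPolynomial C).eval (x / y) := by
  simp only [weightEnumerator, weightPolynomial, map_sum, map_mul, map_pow, MvPolynomial.eval_X,
    eval_finsetSum, eval_pow, eval_X, Finset.mul_sum]
  refine Finset.sum_congr rfl fun c _ => ?_
  have h : y ^ m = y ^ (m - hammingNorm c) * y ^ hammingNorm c := by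
    rw [← pow_add, Nat.sub_add_cancel (hammingNorm_le c)]
  rw [h, div_pow]
  simp
  field_simp

theorem eval_substitute (A : Matrix (Fin 2) (Fin 2) ℂ) (p : MvPolynomial (Fin 2) ℂ) (x y : ℂ) :
    MvPolynomial.eval ![x, y] (substitute A p) =
      MvPolynomial.eval ![A 0 0 * x + A 0 1 * y, A 1 0 * x + A 1 1 * y] p := by
  have h := MvPolynomial.aeval_bind₁ (R := ℂ) (f := ![x, y])
    (g := fun i => MvPolynomial.C (A i 0) * MvPolynomial.X 0 +
      MvPolynomial.C (A i 1) * MvPolynomial.X 1) p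
  rw [MvPolynomial.aeval_eq_eval, MvPolynomial.aeval_eq_eval] at h
  refine h.trans ?_
  congr 2
  funext i
  fin_cases i <;> simp

/-- Evaluate the invariance at `(z, 1)`: the second transformed coordinate is `(z - 1) / √q ≠ 0`, so
it can be divided out. -/
theorem isRoot_macWilliamsMoebius (hC : IsFormallySelfDual C) {z : ℂ} (hz1 : z ≠ 1)
    (hz : (weightPolynomial C).IsRoot z) :
    (weightPolynomial C).IsRoot (macWilliamsMoebius (Fintype.card F) z) := by
  have hs : ((Real.sqrt (Fintype.card F) : ℝ) : ℂ)⁻¹ ≠ 0 := by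
    have : (0 : ℝ) < Fintype.card F := by exact_mod_cast Fintype.card_pos
    exact inv_ne_zero (by exact_mod_cast (Real.sqrt_pos.mpr this).ne')
  have h := congrArg (MvPolynomial.eval ![z, 1]) hC
  rw [eval_substitute, eval_weightEnumerator z one_ne_zero, div_one, hz.eq_zero, mul_zero] at h
  simp only [macWilliamsMatrix, Matrix.smul_apply, Matrix.of_apply, Matrix.cons_val_zero,
    Matrix.cons_val_one, smul_eq_mul, mul_one] at h
  set s := ((Real.sqrt (Fintype.card F) : ℝ) : ℂ)⁻¹
  have hy : s * z + s * (-1) ≠ 0 := by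
    rw [← mul_add]
    exact mul_ne_zero hs (sub_ne_zero.mpr hz1)
  rw [eval_weightEnumerator _ hy] at h
  have h' := (mul_eq_zero.mp h).resolve_left (pow_ne_zero _ hy)
  have e : (s * z + s * (↑(Fintype.card F) - 1)) / (s * z + s * (-1)) =
      macWilliamsMoebius (Fintype.card F) z := by
    rw [← mul_add, ← mul_add, mul_div_mul_left _ _ hs, macWilliamsMoebius]
    ring_nf
  rwa [e] at h'

theorem coeff_weightPolynomial {w : ℕ} (hw : w ≤ m) :
    (weightPolynomial C).coeff (m - w) = (wordsOfWeight C w).card := by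
  classical
  simp only [weightPolynomial, finsetSum_coeff, coeff_X_pow, Finset.sum_boole, wordsOfWeight,
    Finset.filter_filter]
  congr 2
  ext c
  have := hammingNorm_le c
  simp only [Finset.mem_filter, Finset.mem_univ, true_and]
  refine and_congr_right fun _ => ?_
  omega

theorem wordsOfWeight_zero : wordsOfWeight C 0 = {0} := by
  ext c
  rw [mem_wordsOfWeight, Finset.mem_singleton, hammingNorm_eq_zero]
  exact ⟨fun h => h.2, fun h => ⟨h ▸ C.zero_mem, h⟩⟩

theorem natDegree_weightPolynomial_le : (weightPolynomial C).natDegree ≤ m :=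
  natDegree_sum_le_of_forall_le _ _ fun _ _ => (natDegree_X_pow_le _).trans (Nat.sub_le _ _)

theorem coeff_weightPolynomial_self : (weightPolynomial C).coeff m = 1 := by
  have h := coeff_weightPolynomial (C := C) (Nat.zero_le m)
  rwa [wordsOfWeight_zero, Nat.sub_zero, Finset.card_singleton, Nat.cast_one] at h

theorem monic_weightPolynomial : (weightPolynomial C).Monic :=
  monic_of_natDegree_le_of_coeff_eq_one m natDegree_weightPolynomial_le coeff_weightPolynomial_self

theorem natDegree_weightPolynomial : (weightPolynomial C).natDegree = m :=
  natDegree_eq_of_le_of_coeff_ne_zero natDegree_weightPolynomial_le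
    (by rw [coeff_weightPolynomial_self]; exact one_ne_zero)

theorem eval_one_weightPolynomial_ne_zero : (weightPolynomial C).eval 1 ≠ 0 := by
  classical
  simp only [weightPolynomial, eval_finsetSum, eval_pow, eval_X, one_pow, Finset.sum_const,
    nsmul_eq_mul, mul_one, Nat.cast_ne_zero]
  refine Finset.card_ne_zero_of_mem (a := 0) (Finset.mem_filter.mpr ?_)
  exact ⟨Finset.mem_univ 0, C.zero_mem⟩

/-- All exponents are congruent to `m` modulo `D`, so substituting `ζ * z` only multiplies the value
by `ζ ^ m`. -/
theorem isRoot_mul_of_dvd {D : ℕ} (hD : ∀ c ∈ C, D ∣ hammingNorm c) {ζ : ℂ}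
    (hζ : ζ ^ D = 1) {z : ℂ} (hz : (weightPolynomial C).IsRoot z) :
    (weightPolynomial C).IsRoot (ζ * z) := by
  classical
  have h : (weightPolynomial C).eval (ζ * z) = ζ ^ m * (weightPolynomial C).eval z := by
    simp only [weightPolynomial, eval_finsetSum, eval_pow, eval_X, Finset.mul_sum]
    refine Finset.sum_congr rfl fun c hc => ?_
    obtain ⟨k, hk⟩ := hD c (Finset.mem_filter.mp hc).2
    have : ζ ^ m = ζ ^ (m - hammingNorm c) * ζ ^ hammingNorm c := by
      rw [← pow_add, Nat.sub_add_cancel (hammingNorm_le c)]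
    rw [this, hk, pow_mul ζ D k, hζ, one_pow, mul_one, mul_pow]
  rw [IsRoot, h, hz.eq_zero, mul_zero]

end

/-- The number of words of weight `2` in a formally self-dual divisible code. -/
theorem card_wordsOfWeight_two {F : Type*} [Field F] [Fintype F] [DecidableEq F]
    (hq : 4 < Fintype.card F) {n : ℕ} (hn : 0 < n) {C : LinearCode F (2 * n)}
    (hdual : IsFormallySelfDual C) (hdiv : IsDivisible C) :
    (wordsOfWeight C 2).card = n * (Fintype.card F - 1) := by
  obtain ⟨D, hD, hdvd⟩ := hdiv
  have hζ := Complex.isPrimitiveRoot_exp D (by omega)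
  have hroots : ∀ a ∈ (weightPolynomial C).roots, a ^ 2 = 1 - (Fintype.card F : ℂ) := by
    intro a ha
    have h1 : ¬ (weightPolynomial C).IsRoot 1 := eval_one_weightPolynomial_ne_zero
    refine sq_eq_of_mem_finite_invariant hq hD hζ (R := {z | (weightPolynomial C).IsRoot z})
      (finite_setOfPred_isRoot monic_weightPolynomial.ne_zero)
      (fun z hz => isRoot_mul_of_dvd hdvd hζ.pow_eq_one hz) h1
      (fun z hz => isRoot_macWilliamsMoebius hdual (fun h => h1 (h ▸ hz)) hz)
      (isRoot_of_mem_roots ha)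
  have hw1 : (weightPolynomial C).coeff (2 * n - 2 + 1) = 0 := by
    have h := coeff_weightPolynomial (C := C) (w := 1) (by omega)
    rw [show 2 * n - 1 = 2 * n - 2 + 1 by omega] at h
    rw [h, Nat.cast_eq_zero, Finset.card_eq_zero, Finset.eq_empty_iff_forall_notMem]
    intro c hc
    obtain ⟨hc, hc1⟩ := mem_wordsOfWeight.mp hc
    have := hdvd c hc
    rw [hc1, Nat.dvd_one] at this
    omega
  have h := coeff_eq_of_roots_sq_eq monic_weightPolynomial (N := 2 * n - 2)
    (by rw [natDegree_weightPolynomial]; omega) hw1 hroots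
  rw [coeff_weightPolynomial (by omega)] at h
  have e : ((2 * n - 2 : ℕ) : ℂ) + 2 = 2 * n := by
    have : 2 * n - 2 + 2 = 2 * n := by omega
    exact_mod_cast this
  rw [e] at h
  have h' : ((wordsOfWeight C 2).card : ℂ) = (n * (Fintype.card F - 1 : ℕ) : ℕ) := by
    rw [Nat.cast_mul, Nat.cast_sub (by omega), Nat.cast_one]
    linear_combination h / 2
  exact_mod_cast h'

/-! ### Coordinates of the target code, and codes with even weights. -/

section

variable {F : Type*} [Field F]

theorem mem_repetitionCode {v : Fin 2 → F} : v ∈ repetitionCode F ↔ v 0 = v 1 := by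
  rw [repetitionCode, Submodule.mem_span_singleton]
  constructor
  · rintro ⟨a, rfl⟩
    simp
  · intro h
    refine ⟨v 0, ?_⟩
    ext i
    fin_cases i
    · simp
    · simp [h]

theorem mem_directSumCopies_repetitionCode {n : ℕ} {v : Fin (2 * n) → F} :
    v ∈ directSumCopies (repetitionCode F) n ↔
      ∀ (k : ℕ) (hk : k < n), v ⟨2 * k, by omega⟩ = v ⟨2 * k + 1, by omega⟩ := by
  induction n with
  | zero =>
    refine ⟨fun _ k hk => absurd hk (Nat.not_lt_zero k), fun _ => ?_⟩
    have : v = 0 := funext fun i => Fin.elim0 i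
    rw [this]
    exact Submodule.zero_mem _
  | succ n ih =>
    have h : v ∈ directSumCopies (repetitionCode F) (n + 1) ↔
        (fun i : Fin (2 * n) => v (Fin.castAdd 2 i)) ∈ directSumCopies (repetitionCode F) n ∧
        (fun i : Fin 2 => v (Fin.natAdd (2 * n) i)) ∈ repetitionCode F := Iff.rfl
    rw [h, ih, mem_repetitionCode]
    constructor
    · rintro ⟨h1, h2⟩ k hk
      rcases Nat.lt_succ_iff_lt_or_eq.mp hk with hk | rfl
      · exact h1 k hk
      · exact h2
    · intro h
      exact ⟨fun k hk => h k (by omega), h n (by omega)⟩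

theorem monomialMap_apply {m : ℕ} (d : Fin m → F) (σ : Equiv.Perm (Fin m)) (v : Fin m → F)
    (i : Fin m) : monomialMap d σ v i = d i * v (σ i) := by
  rw [monomialMap, Matrix.toLin'_apply, ← Matrix.mulVec_mulVec, Matrix.permMatrix_mulVec,
    Matrix.mulVec_diagonal]
  rfl

variable [DecidableEq F] {m : ℕ}

theorem hammingNorm_eq_add {i j : Fin m} (hij : i ≠ j) (c : Fin m → F) :
    hammingNorm c = (if c i ≠ 0 then 1 else 0) + ((if c j ≠ 0 then 1 else 0) +
      ∑ k ∈ (Finset.univ.erase i).erase j, if c k ≠ 0 then 1 else 0) := by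
  rw [Finset.add_sum_erase _ (fun k => if c k ≠ 0 then 1 else 0)
      (Finset.mem_erase.mpr ⟨hij.symm, Finset.mem_univ j⟩),
    Finset.add_sum_erase _ (fun k => if c k ≠ 0 then 1 else 0) (Finset.mem_univ i), hammingNorm,
    Finset.card_filter]

/-- In a code all of whose weights are even, every codeword is proportional to a codeword of
weight `2` on the support of the latter. -/
theorem mul_eq_mul_of_even [Fintype F] (hq : 2 < Fintype.card F) {C : LinearCode F m}
    (heven : ∀ c ∈ C, 2 ∣ hammingNorm c) {i j : Fin m} (hij : i ≠ j) {u : Fin m → F} (hu : u ∈ C)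
    (hi : u i ≠ 0) (hj : u j ≠ 0) (hk : ∀ k, k ≠ i → k ≠ j → u k = 0) {c : Fin m → F}
    (hc : c ∈ C) : c i * u j = c j * u i := by
  by_contra hne
  -- `c + t • u` is nonzero at both `i` and `j`, while `c - (c i / u i) • u` vanishes at `i` only
  -- among the two. Their weights differ by 1, against evenness.
  obtain ⟨t, ht⟩ : ∃ t : F, t ∉ ({-(c i / u i), -(c j / u j)} : Finset F) := by
    by_contra! h
    have h1 : Fintype.card F ≤ ({-(c i / u i), -(c j / u j)} : Finset F).card :=
      Finset.card_le_card fun x _ => h x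
    have h2 := Finset.card_le_two (a := -(c i / u i)) (b := -(c j / u j))
    omega
  simp only [Finset.mem_insert, Finset.mem_singleton, not_or] at ht
  have hnorm : ∀ s : F, hammingNorm (c + s • u) =
      (if c i + s * u i ≠ 0 then 1 else 0) + ((if c j + s * u j ≠ 0 then 1 else 0) +
      ∑ k ∈ (Finset.univ.erase i).erase j, if c k ≠ 0 then 1 else 0) := by
    intro s
    rw [hammingNorm_eq_add hij]
    simp only [Pi.add_apply, Pi.smul_apply, smul_eq_mul]
    congr 2
    refine Finset.sum_congr rfl fun k hkm => ?_
    simp only [Finset.mem_erase, Finset.mem_univ, and_true] at hkm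
    simp [hk k hkm.2 hkm.1]
  have h1 := heven _ (C.add_mem hc (C.smul_mem (-(c i / u i)) hu))
  have h2 := heven _ (C.add_mem hc (C.smul_mem t hu))
  rw [hnorm, if_neg (by field_simp; simp), if_pos] at h1
  · rw [hnorm, if_pos, if_pos] at h2
    · omega
    · intro h
      apply ht.2
      field_simp
      linear_combination h
    · intro h
      apply ht.1
      field_simp
      linear_combination h
  · intro h
    apply hne
    field_simp at h
    linear_combination -h

end

/-! ### Reconstruction of the code from its words of weight 2. -/

/-- A code with even weights and sufficiently many words of weight `2`. -/
theorem isEquivalent_of_card_wordsOfWeight_two {F : Type*} [Field F] [Fintype F] [DecidableEq F]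
    (hq : 2 < Fintype.card F) {n : ℕ} {C : LinearCode F (2 * n)}
    (heven : ∀ c ∈ C, 2 ∣ hammingNorm c)
    (hcard : n * (Fintype.card F - 1) ≤ (wordsOfWeight C 2).card) :
    IsEquivalent C (directSumCopies (repetitionCode F) n) := by
  set supp : (Fin (2 * n) → F) → Finset (Fin (2 * n)) := fun c => {i | c i ≠ 0} with hsupp
  have mem_supp : ∀ c i, i ∈ supp c ↔ c i ≠ 0 := fun c i => by simp [hsupp]
  have hpair : ∀ u ∈ wordsOfWeight C 2, ∃ i j, i ≠ j ∧ supp u = {i, j} := fun u hu =>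
    Finset.card_eq_two.mp (mem_wordsOfWeight.mp hu).2
  have hprop : ∀ u ∈ C, ∀ i j, i ≠ j → supp u = {i, j} → ∀ c ∈ C, c i * u j = c j * u i := by
    intro u hu i j hij h c hc
    refine mul_eq_mul_of_even hq heven hij hu ((mem_supp u i).mp (by simp [h]))
      ((mem_supp u j).mp (by simp [h])) (fun k hki hkj => ?_) hc
    by_contra hk
    have := (mem_supp u k).mpr hk
    simp [h, hki, hkj] at this
  have hdisj : ∀ u ∈ wordsOfWeight C 2, ∀ c ∈ wordsOfWeight C 2, ∀ x, u x ≠ 0 → c x ≠ 0 →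
      supp u = supp c := by
    intro u hu c hc x hux hcx
    obtain ⟨i, j, hij, h⟩ := hpair u hu
    have hP := hprop u (mem_wordsOfWeight.mp hu).1 i j hij h c (mem_wordsOfWeight.mp hc).1
    have hui : u i ≠ 0 := (mem_supp u i).mp (by simp [h])
    have huj : u j ≠ 0 := (mem_supp u j).mp (by simp [h])
    have hx : x = i ∨ x = j := by simpa [h] using (mem_supp u x).mpr hux
    have hci : c i ≠ 0 := by
      rcases hx with rfl | rfl
      · exact hcx
      · intro h0
        rw [h0, zero_mul] at hP
        exact mul_ne_zero hcx hui hP.symm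
    have hcj : c j ≠ 0 := fun h0 => mul_ne_zero hci huj (by rw [hP, h0, zero_mul])
    refine Finset.eq_of_subset_of_card_le (fun y hy => ?_) ?_
    · have hy' : y = i ∨ y = j := by simpa [h] using hy
      rcases hy' with rfl | rfl
      · exact (mem_supp c y).mpr hci
      · exact (mem_supp c y).mpr hcj
    · exact ((mem_wordsOfWeight.mp hc).2.trans (mem_wordsOfWeight.mp hu).2.symm).le
  -- By proportionality, a word of weight 2 with given support is determined by its nonzero entry at
  -- `i`; each support thus carries at most `q - 1` words.
  have hP : n ≤ ((wordsOfWeight C 2).image supp).card := by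
    have h := Finset.card_le_mul_card_image (f := supp) (wordsOfWeight C 2) (Fintype.card F - 1) ?_
    · exact Nat.le_of_mul_le_mul_left (by rw [mul_comm]; exact hcard.trans h)
        (by omega : 0 < Fintype.card F - 1)
    · intro p hp
      obtain ⟨u, hu, rfl⟩ := Finset.mem_image.mp hp
      obtain ⟨i, j, hij, h⟩ := hpair u hu
      have hF : (Finset.univ.erase (0 : F)).card = Fintype.card F - 1 := by
        rw [Finset.card_erase_of_mem (Finset.mem_univ _), Finset.card_univ]
      rw [← hF]
      refine Finset.card_le_card_of_injOn (fun c => c i) (fun c hc => ?_) ?_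
      · have hc' := (Finset.mem_filter.mp hc).2
        have : i ∈ supp c := by simp [hc', h]
        simpa [mem_supp] using this
      · intro c hc c' hc' hcc
        simp only [Finset.coe_filter, Set.mem_ofPred_eq] at hc hc' hcc
        have hci : c i ≠ 0 := (mem_supp c i).mp (by simp [hc.2, h])
        have hmul := hprop c (mem_wordsOfWeight.mp hc.1).1 i j hij (hc.2.trans h) c'
          (mem_wordsOfWeight.mp hc'.1).1
        funext x
        by_cases hxi : x = i
        · rw [hxi, hcc]
        by_cases hxj : x = j
        · rw [hxj]
          apply mul_left_cancel₀ hci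
          linear_combination hmul + c j * hcc
        · have hx : x ∉ supp u := by simp [h, hxi, hxj]
          have h1 : c x = 0 := by rw [← hc.2, mem_supp, not_not] at hx; exact hx
          have h2 : c' x = 0 := by rw [← hc'.2, mem_supp, not_not] at hx; exact hx
          rw [h1, h2]
  obtain ⟨f⟩ : Nonempty (Fin n ↪ (wordsOfWeight C 2).image supp) :=
    Function.Embedding.nonempty_of_card_le (by rwa [Fintype.card_fin, Fintype.card_coe])
  have hw : ∀ k : Fin n, ∃ w ∈ wordsOfWeight C 2, supp w = (f k : Finset _) := fun k =>
    Finset.mem_image.mp (f k).2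
  choose w hw hwf using hw
  choose i j hij hsw using fun k => hpair (w k) (hw k)
  have hdisj' : ∀ k l x, w k x ≠ 0 → w l x ≠ 0 → k = l := by
    intro k l x hk hl
    have := hdisj _ (hw k) _ (hw l) x hk hl
    rw [hwf, hwf] at this
    exact f.injective (Subtype.ext this)
  set s : Fin n × Fin 2 → Fin (2 * n) := fun p => ![i p.1, j p.1] p.2 with hs
  have hws : ∀ p, w p.1 (s p) ≠ 0 := by
    rintro ⟨k, a⟩
    rw [← mem_supp, hsw]
    fin_cases a <;> simp [hs]
  have hsinj : Function.Injective s := by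
    rintro ⟨k, a⟩ ⟨l, b⟩ h
    obtain rfl : k = l := hdisj' k l _ (hws (k, a)) (by rw [h]; exact hws (l, b))
    have := hij k
    have := (hij k).symm
    fin_cases a <;> fin_cases b <;> simp_all
  have hsbij : Function.Bijective s :=
    (Fintype.bijective_iff_injective_and_card s).mpr ⟨hsinj, by simp [mul_comm]⟩
  set e : Fin n × Fin 2 ≃ Fin (2 * n) := finProdFinEquiv.trans (finCongr (mul_comm n 2)) with he
  have he0 : ∀ k : Fin n, e (k, 0) = ⟨2 * k, by omega⟩ := fun k => by
    ext; simp [he]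
  have he1 : ∀ k : Fin n, e (k, 1) = ⟨2 * k + 1, by omega⟩ := fun k => by
    ext; simp [he, add_comm]
  set σ : Equiv.Perm (Fin (2 * n)) := e.symm.trans (Equiv.ofBijective s hsbij) with hσ
  have hσe : ∀ p, σ (e p) = s p := fun p => by simp [hσ]
  -- `σ` moves the `k`-th support to positions `2k` and `2k + 1`; the scaling turns `w k` into `(1,
  -- 1)` there.
  refine ⟨fun x => (w (e.symm x).1 (σ x))⁻¹, σ, fun x => ?_, ?_⟩
  · have := hws (e.symm x)
    rw [← hσe, e.apply_symm_apply] at this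
    exact inv_ne_zero this
  · have happ : ∀ c p, monomialMap (fun x => (w (e.symm x).1 (σ x))⁻¹) σ c (e p) =
        (w p.1 (s p))⁻¹ * c (s p) := fun c p => by
      rw [monomialMap_apply, hσe, e.symm_apply_apply]
    ext v
    rw [mem_directSumCopies_repetitionCode, Submodule.mem_map]
    constructor
    · rintro ⟨c, hc, rfl⟩ k hk
      have h := hprop _ (mem_wordsOfWeight.mp (hw ⟨k, hk⟩)).1 _ _ (hij _) (hsw _) c hc
      have h0 := happ c (⟨k, hk⟩, 0)
      have h1 := happ c (⟨k, hk⟩, 1)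
      have hn0 := hws (⟨k, hk⟩, 0)
      have hn1 := hws (⟨k, hk⟩, 1)
      rw [he0] at h0
      rw [he1] at h1
      rw [h0, h1]
      simp only [hs, Matrix.cons_val_zero, Matrix.cons_val_one] at hn0 hn1 ⊢
      field_simp
      linear_combination h
    · intro hv
      refine ⟨∑ k, v (e (k, 0)) • w k,
        C.sum_mem fun k _ => C.smul_mem _ (mem_wordsOfWeight.mp (hw k)).1, ?_⟩
      funext x
      obtain ⟨⟨k, a⟩, rfl⟩ := e.surjective x
      rw [happ, Finset.sum_apply, Finset.sum_eq_single k]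
      · have hva : v (e (k, a)) = v (e (k, 0)) := by
          fin_cases a
          · rfl
          · have := hv k k.2
            rw [← he0, ← he1] at this
            exact this.symm
        rw [hva, Pi.smul_apply, smul_eq_mul, mul_comm, mul_assoc, mul_inv_cancel₀ (hws (k, a)),
          mul_one]
      · intro l _ hl
        rw [Pi.smul_apply, smul_eq_mul, mul_eq_zero]
        right
        by_contra h
        exact hl (hdisj' l k _ h (hws (k, a)))
      · simp

end LinCode

theorem mainTheorem5 {F : Type*} [Field F] [Fintype F] [DecidableEq F]
    (hq : 4 < Fintype.card F) (n : ℕ) (C : LinCode.LinearCode F (2 * n))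
    (hdual : LinCode.IsFormallySelfDual C) (hdiv : LinCode.IsDivisible C) :
    LinCode.IsEquivalent C (LinCode.directSumCopies (LinCode.repetitionCode F) n) := by
  -- Length 0 is separate: the count of words of weight 2 reads a coefficient two below the top
  -- degree.
  rcases Nat.eq_zero_or_pos n with rfl | hn
  · refine LinCode.isEquivalent_of_card_wordsOfWeight_two (by omega) (fun c _ => ?_) (by simp)
    have := LinCode.hammingNorm_le c
    rw [show hammingNorm c = 0 by omega]
    exact dvd_zero 2
  have hcard := LinCode.card_wordsOfWeight_two hq hn hdual hdiv
  refine LinCode.isEquivalent_of_card_wordsOfWeight_two (by omega) (fun c hc => ?_) hcard.ge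
  obtain ⟨D, hD, hdvd⟩ := hdiv
  have hpos : 0 < (LinCode.wordsOfWeight C 2).card := by
    rw [hcard]
    exact Nat.mul_pos hn (by omega)
  obtain ⟨u, hu⟩ := Finset.card_pos.mp hpos
  obtain ⟨hu, hu2⟩ := LinCode.mem_wordsOfWeight.mp hu
  have h2 : D ∣ 2 := hu2 ▸ hdvd u hu
  have h3 : D = 2 := ((Nat.dvd_prime Nat.prime_two).mp h2).resolve_left (by omega)
  exact h3 ▸ hdvd c hc
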